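/- Let $m,n\ge 1$, $r=\min\{m,n\}$, and equip $\mathbb{R}^{m\times n}$ with the Frobenius inner product; $\|\cdot\|_F$ and $\|\cdot\|_*$ denote the Frobenius and nuclear norms. Let $f:\mathbb{R}^{m\times n}\to\mathbb{R}$ be differentiable and bounded below, with $\|\nabla f(W)-\nabla f(W')\|_F\le L\|W-W'\|_F$ for all $W,W'$, where $L>0$. Fix $W_0$ and put $\Delta=f(W_0)-\inf_W f(W)$. Muon with constant step size $\eta$ and momentum parameter $\beta\in[0,1)$ starts at $W_0$ and, for $t=0,\dots,T-1$ ($T\ge1$), given a gradient estimate $G_t$ of $\nabla f(W_t)$, sets $M_0=G_0$ and $M_t=\beta M_{t-1}+(1-\beta)G_t$ for $t>0$, takes a compact singular value decomposition $M_t=U_tS_tV_t^\top$ (with $S_t$ of size $\operatorname{rank}M_t$), and sets $W_{t+1}=W_t-\eta U_tV_t^\top$. (1) Stochastic setting. Suppose $f(W)=\mathbb{E}_\xi[f(W;\xi)]$ and that the (jointly measurable) stochastic gradients satisfy, for every $W$, $\mathbb{E}[\nabla f(W;\xi)]=\nabla f(W)$ and $\mathbb{E}\|\nabla f(W;\xi)-\nabla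 f(W)\|_F^2\le\sigma^2$, with $\sigma>0$; suppose also $\Delta>0$. Run Muon with batch size $1$, i.e. $G_t=\nabla f(W_t;\xi_t)$ with $\xi_0,\dots,\xi_{T-1}$ i.i.d. copies of $\xi$, and with $$1-\beta=\min\Big\{\frac{\sqrt{L\Delta}}{\sigma\sqrt T},\,1\Big\},\qquad \eta=\sqrt{\frac{(1-\beta)\Delta}{rTL}} .$$ Then there is an absolute constant $C>0$ such that all the expectations below are finite and $$\frac1T\sum_{t=0}^{T-1}\mathbb{E}\|\nabla f(W_t)\|_*\le C\left(\Big(\frac{r^2L\Delta\sigma^2}{T}\Big)^{1/4}+\sqrt{\frac{rL\Delta}{T}}+\frac{\sqrt r\,\sigma^2}{\sqrt{L\Delta T}}\right).$$ Moreover an $\epsilon$-nuclear norm stationary point is found in expectation with $O(r^2L\sigma^2\Delta\epsilon^{-4})$ stochastic gradient evaluations (one per iteration) for small $\epsilon$: whenever $0<\epsilon\le\sqrt r\,\min\{\sigma,L\Delta/\sigma\}$ and $T\ge C\,r^2L\sigma^2\Delta\,\epsilon^{-4}$, one has $\frac1T\sum_{t<T}\mathbb{E}\|\nabla f(W_t)\|_*\le\epsilon$,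 and in particular $\mathbb{E}\|\nabla f(W_t)\|_*\le\epsilon$ for some $t<T$. (2) Deterministic setting. For every $\beta_0\in[0,1)$ there is a constant $C>0$ depending only on $\beta_0$ such that, if Muon is run with $G_t=\nabla f(W_t)$, any $\beta\in[0,\beta_0]$ and $\eta=\sqrt{\Delta/(rTL)}$, then $$\frac1T\sum_{t=0}^{T-1}\|\nabla f(W_t)\|_*\le C\sqrt{\frac{rL\Delta}{T}} .$$ Moreover an $\epsilon$-nuclear norm stationary point is found with $O(rL\Delta\epsilon^{-2})$ gradient evaluations (one per iteration): for every $\epsilon>0$ and every $T\ge1$ with $T\ge C\,rL\Delta\,\epsilon^{-2}$, one has $\frac1T\sum_{t<T}\|\nabla f(W_t)\|_*\le\epsilon$, and in particular $\|\nabla f(W_t)\|_*\le\epsilon$ for some $t<T$. -/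

import Mathlib

open MeasureTheory ProbabilityTheory

open scoped Matrix Gradient

noncomputable section

namespace Muon

/-- The space of real `m × n` matrices as a Hilbert space: the entries are indexed by
`Fin m × Fin n`, so that the Euclidean norm and inner product are the Frobenius norm and the trace
inner product, and Mathlib's gradient `∇ f` is the gradient with respect to the trace inner
product. -/
abbrev MatrixSpace (m n : ℕ) : Type := EuclideanSpace ℝ (Fin m × Fin n)

/-- The matrix with the same entries. -/
def toMatrix {m n : ℕ} (W : MatrixSpace m n) : Matrix (Fin m) (Fin n) ℝ :=
  Matrix.of fun i j => W (i, j)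

/-- The nuclear norm: the sum of the `min m n` singular values. -/
def nuclearNorm {m n : ℕ} (W : MatrixSpace m n) : ℝ :=
  ∑ i ∈ Finset.range (min m n), (Matrix.toEuclideanLin (toMatrix W)).singularValues i

/-- `W` is an `ε`-nuclear norm stationary point of `f`. -/
def IsNuclearStationary {m n : ℕ} (f : MatrixSpace m n → ℝ) (ε : ℝ) (W : MatrixSpace m n) : Prop :=
  nuclearNorm (∇ f W) ≤ ε

/-- `f` is differentiable and `L` Frobenius norm Lipschitz smooth. -/
def IsFrobeniusSmooth {m n : ℕ} (f : MatrixSpace m n → ℝ) (L : ℝ) : Prop :=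
  Differentiable ℝ f ∧ ∀ W W' : MatrixSpace m n, ‖∇ f W - ∇ f W'‖ ≤ L * ‖W - W'‖

/-- The optimality gap `Δ = f(W₀) - inf f` of the initial point. -/
def initialGap {m n : ℕ} (f : MatrixSpace m n → ℝ) (W₀ : MatrixSpace m n) : ℝ :=
  f W₀ - ⨅ W, f W

/-- `f(W) = 𝔼_ξ[F(W; ξ)]` with `ξ` distributed according to `D`, and `g W ξ` is the stochastic
gradient `∇F(W; ξ)`, which is unbiased with variance at most `σ ^ 2`. -/
structure IsStochasticObjective {m n : ℕ} {Ξ : Type*} [MeasurableSpace Ξ] (D : Measure Ξ)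
    (F : MatrixSpace m n → Ξ → ℝ) (g : MatrixSpace m n → Ξ → MatrixSpace m n)
    (f : MatrixSpace m n → ℝ) (σ : ℝ) : Prop where
  integrable_objective : ∀ W, Integrable (F W) D
  objective_eq : ∀ W, f W = ∫ x, F W x ∂D
  measurable_gradient : Measurable (Function.uncurry g)
  hasGradientAt : ∀ W, ∀ᵐ x ∂D, HasGradientAt (fun W' => F W' x) (g W x) W
  integrable_gradient : ∀ W, Integrable (g W) D
  unbiased : ∀ W, ∫ x, g W x ∂D = ∇ f W
  integrable_sq : ∀ W, Integrable (fun x => ‖g W x - ∇ f W‖ ^ 2) D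
  variance_le : ∀ W, ∫ x, ‖g W x - ∇ f W‖ ^ 2 ∂D ≤ σ ^ 2

/-- The compact singular value decomposition `A = U diag(s) Vᵀ`: the columns of `U` and of `V` are
orthonormal and all `k` diagonal entries are positive (so `k` is the rank of `A`). -/
structure IsCompactSVD {m n k : ℕ} (A : Matrix (Fin m) (Fin n) ℝ) (U : Matrix (Fin m) (Fin k) ℝ)
    (s : Fin k → ℝ) (V : Matrix (Fin n) (Fin k) ℝ) : Prop where
  left_orthonormal : Uᵀ * U = 1
  right_orthonormal : Vᵀ * V = 1
  pos : ∀ i, 0 < s i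
  eq : A = U * Matrix.diagonal s * Vᵀ

/-- `T` iterations of Muon started at `W₀`, with learning rates `η t` and momentum parameter `β`:
`G t` is the gradient estimate used in iteration `t`, `M t` the momentum, `W t` the iterate. -/
structure IsMuonRun {m n : ℕ} (T : ℕ) (W₀ : MatrixSpace m n) (η : ℕ → ℝ) (β : ℝ)
    (G M W : ℕ → MatrixSpace m n) : Prop where
  init : W 0 = W₀
  momentum_zero : 0 < T → M 0 = G 0
  momentum_succ : ∀ t, t + 1 < T → M (t + 1) = β • M t + (1 - β) • G (t + 1)
  step : ∀ t, t < T → ∃ (k : ℕ) (U : Matrix (Fin m) (Fin k) ℝ) (s : Fin k → ℝ)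
    (V : Matrix (Fin n) (Fin k) ℝ), IsCompactSVD (toMatrix (M t)) U s V ∧
      toMatrix (W (t + 1)) = toMatrix (W t) - η t • (U * Vᵀ)

/-- The averaged stochastic gradient `(1 / B) ∑ i, g W (x i)` over a batch `x` of size `B`. -/
def batchGradient {m n B : ℕ} {Ξ : Type*} (g : MatrixSpace m n → Ξ → MatrixSpace m n)
    (W : MatrixSpace m n) (x : Fin B → Ξ) : MatrixSpace m n :=
  (1 / (B : ℝ)) • ∑ i, g W (x i)

/-- The samples `ξ t i` (`t < T`, `i < B`) are independent with law `D`. -/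
structure IsIIDSample {Ω Ξ : Type*} [MeasurableSpace Ω] [MeasurableSpace Ξ] (μ : Measure Ω)
    (D : Measure Ξ) (T B : ℕ) (ξ : ℕ → Fin B → Ω → Ξ) : Prop where
  measurable : ∀ t, t < T → ∀ i, Measurable (ξ t i)
  law : ∀ t, t < T → ∀ i, μ.map (ξ t i) = D
  indep : iIndepFun (fun p : Fin T × Fin B => ξ p.1 p.2) μ

/-- `W` and `M` are the random iterates and momenta of `T` iterations of stochastic Muon, in which
the gradient estimates are batch gradients at the current iterate. -/
def IsStochasticMuonRun {m n B : ℕ} {Ω Ξ : Type*} (T : ℕ) (W₀ : MatrixSpace m n) (η : ℕ → ℝ)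
    (β : ℝ) (g : MatrixSpace m n → Ξ → MatrixSpace m n) (ξ : ℕ → Fin B → Ω → Ξ)
    (M W : ℕ → Ω → MatrixSpace m n) : Prop :=
  ∀ ω, IsMuonRun T W₀ η β (fun t => batchGradient g (W t ω) (fun i => ξ t i ω))
    (fun t => M t ω) (fun t => W t ω)

/-- `T` iterations of Muon in the deterministic setting, where `G t = ∇ f (W t)`. -/
def IsDeterministicMuonRun {m n : ℕ} (T : ℕ) (W₀ : MatrixSpace m n) (η : ℕ → ℝ) (β : ℝ)
    (f : MatrixSpace m n → ℝ) (M W : ℕ → MatrixSpace m n) : Prop :=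
  IsMuonRun T W₀ η β (fun t => ∇ f (W t)) M W

end Muon

end

/-! The polar factor `U * Vᵀ` of the momentum pairs with it at least as well as any other partial
isometry, the value is the nuclear norm, and its Frobenius norm is at most √r. A Muon step therefore
lowers `f` by at least η‖∇f(W_t)‖_*, up to the errors Lη²r and 2η√r‖M_t - ∇f(W_t)‖_F
(`IsMuonRun.descent_step`). Telescoping bounds the sum of the nuclear norms by Δ plus these errors.

The momentum error splits into a drift of at most Lη√r/(1-β) and the moving average of the gradient
noise (`IsMuonRun.norm_momentum_sub_gradient_le`). Without noise only the drift remains. With noise,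
the increments are martingale differences, so the average has second moment at most (β^(2t) + 1 -
β)σ² (`IsStochasticMuonRun.movingAverage_noise`). The term β^(2t) comes from M_0 = G_0 carrying full
weight and produces the last term of the stochastic rate. The choice of η balances Δ/(ηT) against
the drift, and that of β balances both against √(1-β)σ.

The SVD may be chosen arbitrarily at each outcome, so measurability of the iterates needs an
argument: the polar factor of A is the limit of A p_j(AᵀA) for polynomials p_j(x) → 1/√x. -/

namespace Muon

/-! ### Compact SVD, polar factor and nuclear norm. -/

section LinearAlgebra

variable {m n k l : ℕ}

/-- The point of `MatrixSpace m n` with the entries of a given matrix. -/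
noncomputable def ofMatrix (A : Matrix (Fin m) (Fin n) ℝ) : MatrixSpace m n :=
  WithLp.toLp 2 fun p => A p.1 p.2

@[simp]
theorem toMatrix_ofMatrix (A : Matrix (Fin m) (Fin n) ℝ) : toMatrix (ofMatrix A) = A := rfl

@[simp]
theorem ofMatrix_toMatrix (W : MatrixSpace m n) : ofMatrix (toMatrix W) = W := rfl

@[simp]
theorem toMatrix_sub (X Y : MatrixSpace m n) : toMatrix (X - Y) = toMatrix X - toMatrix Y := rfl

@[simp]
theorem toMatrix_smul (c : ℝ) (X : MatrixSpace m n) : toMatrix (c • X) = c • toMatrix X := rfl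

theorem inner_eq_trace (X Y : MatrixSpace m n) :
    inner ℝ X Y = ((toMatrix X)ᵀ * toMatrix Y).trace := by
  simp only [PiLp.inner_apply, Fintype.sum_prod_type, Matrix.trace, Matrix.diag_apply,
    Matrix.mul_apply, Matrix.transpose_apply, toMatrix, Matrix.of_apply]
  rw [Finset.sum_comm]
  simp [mul_comm]

theorem continuous_toMatrix : Continuous (toMatrix : MatrixSpace m n → _) := by
  unfold toMatrix
  fun_prop

theorem continuous_ofMatrix : Continuous (ofMatrix : _ → MatrixSpace m n) := by
  unfold ofMatrix
  fun_prop

/-- Bessel's inequality in matrix form. -/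
theorem diag_mul_mul_transpose_le {X : Matrix (Fin m) (Fin k) ℝ} {Y : Matrix (Fin m) (Fin l) ℝ}
    (hX : Xᵀ * X = 1) (hY : Yᵀ * Y = 1) (i : Fin k) :
    ∑ j, (Xᵀ * Y) i j ^ 2 ≤ 1 := by
  -- `X - Y * (Yᵀ * X)` is the residual of projecting the columns of `X` onto the span of those of
  -- `Y`; its Gram matrix has nonnegative diagonal.
  have h1 : (X - Y * (Yᵀ * X))ᵀ * (X - Y * (Yᵀ * X)) = 1 - (Xᵀ * Y) * (Xᵀ * Y)ᵀ := by
    have h2 : Yᵀ * (Y * (Yᵀ * X)) = Yᵀ * X := by rw [← Matrix.mul_assoc, hY, Matrix.one_mul]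
    simp only [Matrix.transpose_sub, Matrix.transpose_mul, Matrix.transpose_transpose,
      Matrix.sub_mul, Matrix.mul_sub, hX, Matrix.mul_assoc, h2]
    simp
  have h3 : 0 ≤ ((X - Y * (Yᵀ * X))ᵀ * (X - Y * (Yᵀ * X))) i i := by
    rw [Matrix.mul_apply]
    exact Finset.sum_nonneg fun a _ => mul_self_nonneg _
  rw [h1, Matrix.sub_apply, Matrix.one_apply_eq, Matrix.mul_apply] at h3
  simp only [Matrix.transpose_apply, ← pow_two] at h3
  linarith

namespace IsCompactSVD

variable {A : Matrix (Fin m) (Fin n) ℝ} {U : Matrix (Fin m) (Fin k) ℝ} {s : Fin k → ℝ}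
  {V : Matrix (Fin n) (Fin k) ℝ}

theorem transpose_mul_left (h : IsCompactSVD A U s V) : Aᵀ * U = V * Matrix.diagonal s := by
  rw [h.eq]
  simp only [Matrix.transpose_mul, Matrix.transpose_transpose, Matrix.diagonal_transpose,
    Matrix.mul_assoc, h.left_orthonormal, Matrix.mul_one]

theorem trace_transpose_mul_polar (h : IsCompactSVD A U s V) :
    (Aᵀ * (U * Vᵀ)).trace = ∑ i, s i := by
  rw [← Matrix.mul_assoc, h.transpose_mul_left, Matrix.trace_mul_comm, ← Matrix.mul_assoc,
    h.right_orthonormal, Matrix.one_mul, Matrix.trace_diagonal]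

theorem trace_polar_self (h : IsCompactSVD A U s V) :
    ((U * Vᵀ)ᵀ * (U * Vᵀ)).trace = k := by
  have : (U * Vᵀ)ᵀ * (U * Vᵀ) = V * Vᵀ := by
    rw [Matrix.transpose_mul, Matrix.transpose_transpose, Matrix.mul_assoc, ← Matrix.mul_assoc Uᵀ,
      h.left_orthonormal, Matrix.one_mul]
  rw [this, Matrix.trace_mul_comm, h.right_orthonormal, Matrix.trace_one, Fintype.card_fin]

theorem card_le (h : IsCompactSVD A U s V) : k ≤ min m n := by
  have aux : ∀ {p : ℕ} {X : Matrix (Fin p) (Fin k) ℝ}, Xᵀ * X = 1 → k ≤ p := by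
    intro p X hX
    calc k = (1 : Matrix (Fin k) (Fin k) ℝ).rank := by rw [Matrix.rank_one, Fintype.card_fin]
      _ = (Xᵀ * X).rank := by rw [hX]
      _ ≤ X.rank := Matrix.rank_mul_le_right _ _
      _ ≤ p := Matrix.rank_le_height X
  exact le_min (aux h.left_orthonormal) (aux h.right_orthonormal)

/-- Partial isometries pair with `A` to at most the sum of the singular values of `A`. -/
theorem trace_transpose_mul_le (h : IsCompactSVD A U s V) {U' : Matrix (Fin m) (Fin l) ℝ}
    {V' : Matrix (Fin n) (Fin l) ℝ} (hU : U'ᵀ * U' = 1) (hV : V'ᵀ * V' = 1) :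
    (Aᵀ * (U' * V'ᵀ)).trace ≤ ∑ i, s i := by
  have h1 : (Aᵀ * (U' * V'ᵀ)).trace
      = (Matrix.diagonal s * ((Uᵀ * U') * (Vᵀ * V')ᵀ)).trace := by
    rw [h.eq]
    simp only [Matrix.transpose_mul, Matrix.transpose_transpose, Matrix.diagonal_transpose,
      Matrix.mul_assoc]
    rw [Matrix.trace_mul_comm]
    simp only [Matrix.mul_assoc]
  rw [h1, Matrix.trace]
  refine Finset.sum_le_sum fun i _ => ?_
  rw [Matrix.diag_apply, Matrix.diagonal_mul, Matrix.mul_apply]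
  refine mul_le_of_le_one_right (h.pos i).le ?_
  have hb1 := diag_mul_mul_transpose_le h.left_orthonormal hU i
  have hb2 := diag_mul_mul_transpose_le h.right_orthonormal hV i
  calc ∑ j, (Uᵀ * U') i j * (Vᵀ * V')ᵀ j i
      ≤ ∑ j, ((Uᵀ * U') i j ^ 2 + (Vᵀ * V') i j ^ 2) / 2 := by
        refine Finset.sum_le_sum fun j _ => ?_
        rw [Matrix.transpose_apply]
        nlinarith [sq_nonneg ((Uᵀ * U') i j - (Vᵀ * V') i j)]
    _ ≤ 1 := by
        rw [← Finset.sum_div, Finset.sum_add_distrib]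
        linarith

theorem mul_pow_transpose_mul (h : IsCompactSVD A U s V) (j : ℕ) :
    A * (Aᵀ * A) ^ j = U * Matrix.diagonal (fun i => s i * (s i ^ 2) ^ j) * Vᵀ := by
  induction j with
  | zero => simpa using h.eq
  | succ j ih =>
    have e : Vᵀ * (Aᵀ * A) = Matrix.diagonal (fun i => s i ^ 2) * Vᵀ := by
      have e1 : Vᵀ * Aᵀ = Matrix.diagonal s * Uᵀ := by
        conv_lhs => rw [h.eq]
        simp only [Matrix.transpose_mul, Matrix.transpose_transpose, Matrix.diagonal_transpose]
        rw [← Matrix.mul_assoc, h.right_orthonormal, Matrix.one_mul]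
      have e2 : Uᵀ * A = Matrix.diagonal s * Vᵀ := by
        conv_lhs => rw [h.eq]
        rw [Matrix.mul_assoc, ← Matrix.mul_assoc, h.left_orthonormal, Matrix.one_mul]
      rw [← Matrix.mul_assoc, e1, Matrix.mul_assoc, e2, ← Matrix.mul_assoc,
        Matrix.diagonal_mul_diagonal]
      simp only [pow_two]
    rw [pow_succ, ← Matrix.mul_assoc, ih, Matrix.mul_assoc, e, ← Matrix.mul_assoc,
      Matrix.mul_assoc U, Matrix.diagonal_mul_diagonal]
    simp only [pow_succ, mul_assoc]

/-- Odd functional calculus: each singular value s becomes s p(s²). With p(x) near 1/√x this is near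
1, which leaves the polar factor. -/
theorem mul_aeval_transpose_mul (h : IsCompactSVD A U s V) (p : Polynomial ℝ) :
    A * Polynomial.aeval (Aᵀ * A) p
      = U * Matrix.diagonal (fun i => s i * p.eval (s i ^ 2)) * Vᵀ := by
  induction p using Polynomial.induction_on' with
  | add p q hp hq =>
    rw [map_add, Matrix.mul_add, hp, hq, ← Matrix.add_mul, ← Matrix.mul_add,
      Matrix.diagonal_add]
    simp only [Polynomial.eval_add, mul_add]
  | monomial j a =>
    rw [Polynomial.aeval_monomial, ← Algebra.smul_def, Matrix.mul_smul, h.mul_pow_transpose_mul,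
      ← Matrix.smul_mul, ← Matrix.mul_smul, ← Matrix.diagonal_smul]
    congr 3
    ext i
    simp [Polynomial.eval_monomial]
    ring

end IsCompactSVD

/-- Polynomials converging pointwise to `x ↦ 1 / √x` on the positive reals. -/
theorem exists_polynomial_tendsto_inv_sqrt :
    ∃ p : ℕ → Polynomial ℝ, ∀ x : ℝ, 0 < x →
      Filter.Tendsto (fun j => (p j).eval x) Filter.atTop (nhds (√x)⁻¹) := by
  -- Since 1/√x blows up at 0, approximation is uniform only on compact intervals, chosen here to
  -- exhaust the positive reals.
  have h : ∀ j : ℕ, ∃ p : Polynomial ℝ, ∀ x ∈ Set.Icc (1 / ((j : ℝ) + 1)) (j + 1),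
      |p.eval x - (√x)⁻¹| < 1 / ((j : ℝ) + 1) := by
    intro j
    have hj : 0 < 1 / ((j : ℝ) + 1) := by positivity
    refine exists_polynomial_near_of_continuousOn _ _ _ ?_ _ hj
    refine ContinuousOn.inv₀ (by fun_prop) fun x hx => ?_
    exact (Real.sqrt_pos.2 (hj.trans_le hx.1)).ne'
  choose p hp using h
  refine ⟨p, fun x hx => ?_⟩
  have h0 := tendsto_one_div_add_atTop_nhds_zero_nat (𝕜 := ℝ)
  have e1 := h0.eventually (ge_mem_nhds hx)
  have e2 : ∀ᶠ j : ℕ in Filter.atTop, x ≤ (j : ℝ) + 1 := by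
    filter_upwards [Filter.eventually_ge_atTop ⌈x⌉₊] with j hj
    have := Nat.le_of_ceil_le hj
    linarith
  rw [tendsto_iff_dist_tendsto_zero]
  refine squeeze_zero' (Filter.Eventually.of_forall fun j => dist_nonneg) ?_ h0
  filter_upwards [e1, e2] with j h1 h2
  rw [Real.dist_eq]
  exact (hp j x ⟨h1, h2⟩).le

/-- The orthogonal polar factor is a pointwise limit of fixed continuous functions. -/
theorem exists_continuous_tendsto_polar (m n : ℕ) :
    ∃ q : ℕ → MatrixSpace m n → MatrixSpace m n, (∀ j, Continuous (q j)) ∧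
      ∀ (X : MatrixSpace m n) (k : ℕ) (U : Matrix (Fin m) (Fin k) ℝ) (s : Fin k → ℝ)
        (V : Matrix (Fin n) (Fin k) ℝ), IsCompactSVD (toMatrix X) U s V →
        Filter.Tendsto (fun j => q j X) Filter.atTop (nhds (ofMatrix (U * Vᵀ))) := by
  obtain ⟨p, hp⟩ := exists_polynomial_tendsto_inv_sqrt
  refine ⟨fun j X => ofMatrix (toMatrix X *
    Polynomial.aeval ((toMatrix X)ᵀ * toMatrix X) (p j)), fun j => ?_, fun X k U s V h => ?_⟩
  · refine continuous_ofMatrix.comp (continuous_toMatrix.matrix_mul ?_)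
    exact (p j).continuous_aeval.comp
      (continuous_toMatrix.matrix_transpose.matrix_mul continuous_toMatrix)
  · refine (continuous_ofMatrix.tendsto _).comp ?_
    simp only [h.mul_aeval_transpose_mul]
    have h1 : Filter.Tendsto (fun j => fun i => s i * (p j).eval (s i ^ 2)) Filter.atTop
        (nhds (fun _ => (1 : ℝ))) := by
      refine tendsto_pi_nhds.2 fun i => ?_
      have := (hp (s i ^ 2) (pow_pos (h.pos i) 2)).const_mul (s i)
      rwa [Real.sqrt_sq (h.pos i).le, mul_inv_cancel₀ (h.pos i).ne'] at this
    have h2 : Continuous fun d : Fin k → ℝ => U * Matrix.diagonal d * Vᵀ := by fun_prop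
    have h3 := (h2.tendsto _).comp h1
    rw [Matrix.diagonal_one, Matrix.mul_one] at h3
    exact h3

-- The right vectors are eigenvectors b_i of T*T. Their images T b_i are orthogonal of length σ_i,
-- so dividing by σ_i gives the left vectors. This ties the singular values defining `nuclearNorm`
-- to `IsCompactSVD`.
set_option maxHeartbeats 600000 in
theorem exists_isCompactSVD (A : Matrix (Fin m) (Fin n) ℝ) :
    ∃ (k : ℕ) (U : Matrix (Fin m) (Fin k) ℝ) (V : Matrix (Fin n) (Fin k) ℝ),
      IsCompactSVD A U (fun i => (Matrix.toEuclideanLin A).singularValues i) V ∧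
      k = Module.finrank ℝ (Matrix.toEuclideanLin A).range := by
  set T := Matrix.toEuclideanLin A with hT
  have hn : Module.finrank ℝ (EuclideanSpace ℝ (Fin n)) = n := finrank_euclideanSpace_fin
  set b := T.isSymmetric_adjoint_comp_self.eigenvectorBasis hn with hb
  have hin : ∀ i j, inner ℝ (T (b i)) (T (b j)) =
      if i = j then T.singularValues j ^ 2 else 0 := by
    intro i j
    rw [← LinearMap.adjoint_inner_right, ← LinearMap.comp_apply,
      T.isSymmetric_adjoint_comp_self.apply_eigenvectorBasis, T.sq_singularValues_fin hn,
      inner_smul_right, orthonormal_iff_ite.1 b.orthonormal]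
    simp
  have hk : Module.finrank ℝ T.range ≤ n := by
    simpa [hn] using T.finrank_range_le
  have hpos : ∀ i : Fin (Module.finrank ℝ T.range), 0 < T.singularValues i := fun i =>
    T.singularValues_pos_iff_lt_finrank_range.2 i.2
  refine ⟨_, Matrix.of fun a i => T (b (Fin.castLE hk i)) a / T.singularValues i,
    Matrix.of fun a i => b (Fin.castLE hk i) a, ⟨?_, ?_, hpos, ?_⟩, rfl⟩
  · ext i j
    have := hin (Fin.castLE hk i) (Fin.castLE hk j)
    simp only [PiLp.inner_apply, Fin.castLE_inj, Fin.val_castLE] at this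
    simp only [Matrix.mul_apply, Matrix.transpose_apply, Matrix.of_apply, Matrix.one_apply]
    have e : ∀ a, T (b (Fin.castLE hk i)) a / T.singularValues i *
        (T (b (Fin.castLE hk j)) a / T.singularValues j) =
        inner ℝ (T (b (Fin.castLE hk i)) a) (T (b (Fin.castLE hk j)) a) /
          (T.singularValues i * T.singularValues j) := by
      intro a
      simp
      ring
    simp only [e, ← Finset.sum_div, this]
    split_ifs with hij
    · subst hij
      have := (hpos i).ne'
      field_simp
    · simp
  · ext i j
    have := orthonormal_iff_ite.1 b.orthonormal (Fin.castLE hk i) (Fin.castLE hk j)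
    simp only [PiLp.inner_apply, Fin.castLE_inj] at this
    simp only [Matrix.mul_apply, Matrix.transpose_apply, Matrix.of_apply, Matrix.one_apply, ← this]
    exact Finset.sum_congr rfl fun a _ => mul_comm _ _
  · ext a c
    -- Column c of `A` is T applied to the expansion of the c-th standard vector in `b`; the terms
    -- with index beyond the rank vanish because T kills those b_i.
    have h1 := b.sum_repr' (EuclideanSpace.single c (1 : ℝ))
    have h2 := congrArg (fun x => T x a) h1
    have h3 : T (EuclideanSpace.single c 1) a = A a c := by
      simp [hT, Matrix.toLpLin_apply]
    simp only [h3, map_sum, map_smul] at h2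
    rw [← h2, Matrix.mul_assoc, Matrix.mul_apply]
    simp only [Matrix.diagonal_mul, Matrix.of_apply, Matrix.transpose_apply]
    rw [WithLp.ofLp_sum, Finset.sum_apply]
    symm
    refine Fintype.sum_of_injective (Fin.castLE hk) (Fin.castLE_injective hk) _ _ ?_ ?_
    · intro i hi
      have : T (b i) = 0 := by
        rw [← inner_self_eq_zero (𝕜 := ℝ), hin, if_pos rfl, sq_eq_zero_iff,
          T.singularValues_eq_zero_iff_le_finrank_range]
        by_contra hlt
        exact hi ⟨⟨i, not_le.1 hlt⟩, rfl⟩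
      simp [this]
    · intro i
      have := (hpos i).ne'
      rw [EuclideanSpace.inner_single_right]
      simp
      field_simp

theorem exists_isCompactSVD_nuclearNorm (X : MatrixSpace m n) :
    ∃ (k : ℕ) (U : Matrix (Fin m) (Fin k) ℝ) (s : Fin k → ℝ) (V : Matrix (Fin n) (Fin k) ℝ),
      IsCompactSVD (toMatrix X) U s V ∧ nuclearNorm X = ∑ i, s i := by
  obtain ⟨k, U, V, h, hk⟩ := exists_isCompactSVD (toMatrix X)
  refine ⟨k, U, _, V, h, ?_⟩
  rw [nuclearNorm, Fin.sum_univ_eq_sum_range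
    (fun i => (Matrix.toEuclideanLin (toMatrix X)).singularValues i)]
  symm
  refine Finset.sum_subset (Finset.range_subset_range.2 h.card_le) fun i _ hi => ?_
  rw [LinearMap.singularValues_eq_zero_iff_le_finrank_range, ← hk]
  simpa using hi

theorem nuclearNorm_nonneg (X : MatrixSpace m n) : 0 ≤ nuclearNorm X :=
  Finset.sum_nonneg fun i _ => LinearMap.singularValues_nonneg _ i

theorem IsCompactSVD.norm_polar_le {A : Matrix (Fin m) (Fin n) ℝ} {U : Matrix (Fin m) (Fin k) ℝ}
    {s : Fin k → ℝ} {V : Matrix (Fin n) (Fin k) ℝ} (h : IsCompactSVD A U s V) :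
    ‖ofMatrix (U * Vᵀ)‖ ≤ √(min m n : ℕ) := by
  refine Real.le_sqrt_of_sq_le ?_
  rw [← real_inner_self_eq_norm_sq, inner_eq_trace, toMatrix_ofMatrix, h.trace_polar_self]
  exact_mod_cast h.card_le

/-- Pairing with the polar factor of a nearby matrix almost attains the nuclear norm. -/
theorem nuclearNorm_le_inner_polar {X Y : MatrixSpace m n} {U : Matrix (Fin m) (Fin k) ℝ}
    {s : Fin k → ℝ} {V : Matrix (Fin n) (Fin k) ℝ} (h : IsCompactSVD (toMatrix Y) U s V) :
    nuclearNorm X ≤ inner ℝ Y (ofMatrix (U * Vᵀ)) + √(min m n : ℕ) * ‖X - Y‖ := by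
  obtain ⟨l, U', s', V', h', hX⟩ := exists_isCompactSVD_nuclearNorm X
  have e1 : nuclearNorm X = inner ℝ X (ofMatrix (U' * V'ᵀ)) := by
    rw [hX, inner_eq_trace, toMatrix_ofMatrix, h'.trace_transpose_mul_polar]
  -- The polar factor of `X` is only a competitor for `Y`, whose own polar factor is optimal.
  have e2 : inner ℝ Y (ofMatrix (U' * V'ᵀ)) ≤ inner ℝ Y (ofMatrix (U * Vᵀ)) := by
    rw [inner_eq_trace, inner_eq_trace, toMatrix_ofMatrix, toMatrix_ofMatrix,
      h.trace_transpose_mul_polar]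
    exact h.trace_transpose_mul_le h'.left_orthonormal h'.right_orthonormal
  have e3 : inner ℝ (X - Y) (ofMatrix (U' * V'ᵀ)) ≤ √(min m n : ℕ) * ‖X - Y‖ := by
    refine (real_inner_le_norm _ _).trans ?_
    rw [mul_comm]
    gcongr
    exact h'.norm_polar_le
  rw [inner_sub_left] at e3
  linarith

theorem nuclearNorm_le_add (X Y : MatrixSpace m n) :
    nuclearNorm X ≤ nuclearNorm Y + √(min m n : ℕ) * ‖X - Y‖ := by
  obtain ⟨l, U, s, V, h, hY⟩ := exists_isCompactSVD_nuclearNorm Y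
  have := nuclearNorm_le_inner_polar (X := X) h
  rwa [inner_eq_trace, toMatrix_ofMatrix, h.trace_transpose_mul_polar, ← hY] at this

@[simp]
theorem nuclearNorm_zero : nuclearNorm (0 : MatrixSpace m n) = 0 := by
  have : toMatrix (0 : MatrixSpace m n) = 0 := rfl
  simp [nuclearNorm, this]

theorem nuclearNorm_le_norm (X : MatrixSpace m n) : nuclearNorm X ≤ √(min m n : ℕ) * ‖X‖ := by
  simpa using nuclearNorm_le_add X 0

theorem continuous_nuclearNorm : Continuous (nuclearNorm : MatrixSpace m n → ℝ) := by
  refine (LipschitzWith.of_le_add_mul ⟨√(min m n : ℕ), Real.sqrt_nonneg _⟩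
    fun X Y => ?_).continuous
  rw [dist_eq_norm]
  exact nuclearNorm_le_add X Y

end LinearAlgebra

/-! ### Descent inequality and momentum error along one run. -/

section Descent

variable {m n : ℕ} {f : MatrixSpace m n → ℝ} {L : ℝ}

/-- The mean value theorem on the segment gives the constant L instead of the sharp L/2, which
affects only the final constants. -/
theorem IsFrobeniusSmooth.le_add_inner (hf : IsFrobeniusSmooth f L) (hL : 0 ≤ L)
    (x y : MatrixSpace m n) :
    f y ≤ f x + inner ℝ (∇ f x) (y - x) + L * ‖y - x‖ ^ 2 := by
  obtain ⟨z, hz, hzeq⟩ := domain_mvt (f := f) (s := Set.univ) (x := x) (y := y)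
    (f' := fun z => InnerProductSpace.toDual ℝ _ (∇ f z))
    (fun z _ => (hf.1 z).hasGradientAt.hasFDerivAt.hasFDerivWithinAt)
    convex_univ (Set.mem_univ _) (Set.mem_univ _)
  rw [InnerProductSpace.toDual_apply_apply] at hzeq
  have h1 : inner ℝ (∇ f z - ∇ f x) (y - x) ≤ L * ‖y - x‖ ^ 2 := by
    have h2 : ‖z - x‖ ≤ ‖y - x‖ := by
      obtain ⟨θ, hθ, rfl⟩ := (segment_eq_image_lineMap ℝ x y).subset hz
      rw [← dist_eq_norm, dist_lineMap_left, dist_comm, dist_eq_norm, Real.norm_of_nonneg hθ.1]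
      exact mul_le_of_le_one_left (norm_nonneg _) hθ.2
    calc inner ℝ (∇ f z - ∇ f x) (y - x) ≤ ‖∇ f z - ∇ f x‖ * ‖y - x‖ := real_inner_le_norm _ _
      _ ≤ (L * ‖y - x‖) * ‖y - x‖ := by
        gcongr
        exact (hf.2 z x).trans (by gcongr)
      _ = L * ‖y - x‖ ^ 2 := by ring
  rw [inner_sub_left] at h1
  linarith

theorem IsFrobeniusSmooth.continuous_gradient (hf : IsFrobeniusSmooth f L) (hL : 0 ≤ L) :
    Continuous (∇ f) := by
  refine (LipschitzWith.of_dist_le_mul (K := ⟨L, hL⟩) fun x y => ?_).continuous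
  rw [dist_eq_norm, dist_eq_norm]
  exact hf.2 x y

variable {T : ℕ} {W₀ : MatrixSpace m n} {η β : ℝ} {G M W : ℕ → MatrixSpace m n}

/-- Every step of Muon moves along the orthogonal polar factor of the momentum. -/
theorem IsMuonRun.exists_polar (h : IsMuonRun T W₀ (fun _ => η) β G M W) {t : ℕ} (ht : t < T) :
    ∃ (k : ℕ) (U : Matrix (Fin m) (Fin k) ℝ) (s : Fin k → ℝ) (V : Matrix (Fin n) (Fin k) ℝ),
      IsCompactSVD (toMatrix (M t)) U s V ∧ W (t + 1) = W t - η • ofMatrix (U * Vᵀ) := by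
  obtain ⟨k, U, s, V, hs, hW⟩ := h.step t ht
  refine ⟨k, U, s, V, hs, ?_⟩
  have := congrArg ofMatrix hW
  rwa [ofMatrix_toMatrix, ← toMatrix_ofMatrix (U * Vᵀ), ← toMatrix_smul, ← toMatrix_sub,
    ofMatrix_toMatrix] at this

theorem IsMuonRun.norm_step_le (h : IsMuonRun T W₀ (fun _ => η) β G M W) (hη : 0 ≤ η) {t : ℕ}
    (ht : t < T) : ‖W t - W (t + 1)‖ ≤ η * √(min m n : ℕ) := by
  obtain ⟨k, U, s, V, hs, hW⟩ := h.exists_polar ht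
  rw [hW, sub_sub_cancel, norm_smul, Real.norm_of_nonneg hη]
  gcongr
  exact hs.norm_polar_le

theorem IsMuonRun.norm_sub_init_le (h : IsMuonRun T W₀ (fun _ => η) β G M W) (hη : 0 ≤ η) {t : ℕ}
    (ht : t ≤ T) : ‖W t - W₀‖ ≤ t * (η * √(min m n : ℕ)) := by
  induction t with
  | zero => simp [h.init]
  | succ t ih =>
    have h1 := ih (by lia)
    have h2 := h.norm_step_le hη (t := t) (by lia)
    have h3 : W (t + 1) - W₀ = (W t - W₀) - (W t - W (t + 1)) := by abel
    rw [h3]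
    refine (norm_sub_le _ _).trans ?_
    rw [Nat.cast_succ]
    linarith

/-- The momentum error is paid twice, hence the factor 2: once in passing from the nuclear norm of
the gradient to the pairing of `M t` with its polar factor, once in replacing `M t` by the gradient
in that pairing. -/
theorem IsMuonRun.descent_step (h : IsMuonRun T W₀ (fun _ => η) β G M W) (hη : 0 ≤ η)
    (hL : 0 ≤ L) (hf : IsFrobeniusSmooth f L) {t : ℕ} (ht : t < T) :
    η * nuclearNorm (∇ f (W t)) ≤ f (W t) - f (W (t + 1)) + L * η ^ 2 * (min m n : ℕ)
      + 2 * η * √(min m n : ℕ) * ‖M t - ∇ f (W t)‖ := by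
  obtain ⟨k, U, s, V, hs, hW⟩ := h.exists_polar ht
  have h1 := nuclearNorm_le_inner_polar (X := ∇ f (W t)) hs
  have h2 := hf.le_add_inner hL (W t) (W (t + 1))
  have h3 : ‖W (t + 1) - W t‖ ^ 2 ≤ η ^ 2 * (min m n : ℕ) := by
    rw [norm_sub_rev]
    have := pow_le_pow_left₀ (norm_nonneg _) (h.norm_step_le hη ht) 2
    rwa [mul_pow, Real.sq_sqrt (Nat.cast_nonneg _)] at this
  have h4 : W (t + 1) - W t = -(η • ofMatrix (U * Vᵀ)) := by rw [hW]; abel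
  have h5 : inner ℝ (M t - ∇ f (W t)) (ofMatrix (U * Vᵀ))
      ≤ √(min m n : ℕ) * ‖M t - ∇ f (W t)‖ := by
    refine (real_inner_le_norm _ _).trans ?_
    rw [mul_comm]
    gcongr
    exact hs.norm_polar_le
  have h6 : L * ‖W (t + 1) - W t‖ ^ 2 ≤ L * (η ^ 2 * (min m n : ℕ)) := by gcongr
  rw [h4, inner_neg_right, inner_smul_right, ← h4] at h2
  rw [inner_sub_left] at h5
  rw [norm_sub_rev] at h1
  have h7 := mul_le_mul_of_nonneg_left (add_le_add h1 h5) hη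
  linarith

theorem IsMuonRun.sum_nuclearNorm_le (h : IsMuonRun T W₀ (fun _ => η) β G M W) (hη : 0 ≤ η)
    (hL : 0 ≤ L) (hf : IsFrobeniusSmooth f L) (hb : BddBelow (Set.range f)) :
    η * ∑ t ∈ Finset.range T, nuclearNorm (∇ f (W t)) ≤
      initialGap f W₀ + T * (L * η ^ 2 * (min m n : ℕ))
        + 2 * η * √(min m n : ℕ) * ∑ t ∈ Finset.range T, ‖M t - ∇ f (W t)‖ := by
  have h1 := Finset.sum_le_sum fun t (ht : t ∈ Finset.range T) =>
    h.descent_step hη hL hf (Finset.mem_range.1 ht)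
  rw [Finset.sum_add_distrib, Finset.sum_add_distrib, Finset.sum_range_sub', Finset.sum_const,
    Finset.card_range, nsmul_eq_mul, ← Finset.mul_sum, ← Finset.mul_sum, h.init] at h1
  have h2 : ⨅ X, f X ≤ f (W T) := ciInf_le hb _
  rw [initialGap]
  linarith

/-- Exponential moving average of a sequence, started at its first term. -/
def movingAverage {E : Type*} [AddCommGroup E] [Module ℝ E] (β : ℝ) (ν : ℕ → E) : ℕ → E
  | 0 => ν 0
  | t + 1 => β • movingAverage β ν t + (1 - β) • ν (t + 1)

theorem movingAverage_zero {E : Type*} [AddCommGroup E] [Module ℝ E] (β : ℝ) (t : ℕ) :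
    movingAverage β (fun _ => (0 : E)) t = 0 := by
  induction t with
  | zero => rfl
  | succ t ih => simp [movingAverage, ih]

/-- The momentum follows the gradient up to the averaged noise and a drift term. -/
theorem IsMuonRun.norm_momentum_sub_gradient_le (h : IsMuonRun T W₀ (fun _ => η) β G M W)
    (hη : 0 ≤ η) (hL : 0 ≤ L) (hf : IsFrobeniusSmooth f L) (hβ : 0 ≤ β) (hβ1 : β < 1) {t : ℕ}
    (ht : t < T) :
    ‖M t - ∇ f (W t)‖ ≤ ‖movingAverage β (fun t => G t - ∇ f (W t)) t‖
      + L * (η * √(min m n : ℕ)) / (1 - β) := by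
  set K := L * (η * √(min m n : ℕ)) / (1 - β) with hK
  have hα : 0 < 1 - β := by linarith
  have hK0 : 0 ≤ K := by positivity
  have hKe : L * (η * √(min m n : ℕ)) = (1 - β) * K := by rw [hK]; field_simp
  have key : ‖M t - ∇ f (W t) - movingAverage β (fun t => G t - ∇ f (W t)) t‖ ≤ K := by
    induction t with
    | zero => simpa [movingAverage, h.momentum_zero ht] using hK0
    | succ t ih =>
      have h1 := ih (by lia)
      have h2 : ‖∇ f (W t) - ∇ f (W (t + 1))‖ ≤ (1 - β) * K := by
        rw [← hKe]
        refine (hf.2 _ _).trans ?_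
        gcongr
        exact h.norm_step_le hη (by lia)
      -- The deviation contracts by β and gains one gradient increment. The bound `K` survives
      -- because β(K + (1-β)K) = K - (1-β)²K.
      have h3 : M (t + 1) - ∇ f (W (t + 1))
            - movingAverage β (fun t => G t - ∇ f (W t)) (t + 1)
          = β • (M t - ∇ f (W t) - movingAverage β (fun t => G t - ∇ f (W t)) t)
            + β • (∇ f (W t) - ∇ f (W (t + 1))) := by
        rw [h.momentum_succ t ht, movingAverage]
        module
      rw [h3]
      refine (norm_add_le _ _).trans ?_
      rw [norm_smul, norm_smul, Real.norm_of_nonneg hβ]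
      have h4 := mul_le_mul_of_nonneg_left (add_le_add h1 h2) hβ
      nlinarith [mul_nonneg (mul_nonneg hα.le hα.le) hK0]
  have := norm_sub_norm_le (M t - ∇ f (W t)) (movingAverage β (fun t => G t - ∇ f (W t)) t)
  linarith

end Descent

/-! ### The deterministic rate. -/

section Deterministic

variable {m n : ℕ} {f : MatrixSpace m n → ℝ} {L β η : ℝ} {W₀ : MatrixSpace m n} {T : ℕ}
  {M W : ℕ → MatrixSpace m n}

theorem gradient_eq_zero_of_initialGap_le (hb : BddBelow (Set.range f))
    (h : initialGap f W₀ ≤ 0) : ∇ f W₀ = 0 := by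
  have hmin : IsLocalMin f W₀ := Filter.Eventually.of_forall fun X => by
    have := ciInf_le hb X
    rw [initialGap] at h
    linarith
  rw [gradient, hmin.fderiv_eq_zero, map_zero]

theorem initialGap_nonneg (hb : BddBelow (Set.range f)) : 0 ≤ initialGap f W₀ :=
  sub_nonneg.2 (ciInf_le hb W₀)

theorem IsDeterministicMuonRun.average_nuclearNorm_le {c : ℝ} (hm : 0 < m) (hn : 0 < n)
    (hL : 0 < L) (hT : 1 ≤ T) (hb : BddBelow (Set.range f)) (hf : IsFrobeniusSmooth f L)
    (hη : η = √(initialGap f W₀ / ((min m n : ℕ) * T * L))) (hβ : 0 ≤ β) (hβ1 : β < 1)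
    (hc : 2 + 2 / (1 - β) ≤ c) (h : IsDeterministicMuonRun T W₀ (fun _ => η) β f M W) :
    (1 / (T : ℝ)) * ∑ t ∈ Finset.range T, nuclearNorm (∇ f (W t)) ≤
      c * √((min m n : ℕ) * L * initialGap f W₀ / T) := by
  have hr : (0 : ℝ) < (min m n : ℕ) := by exact_mod_cast lt_min hm hn
  have hT0 : (0 : ℝ) < T := by exact_mod_cast hT
  have hα : 0 < 1 - β := by linarith
  have hη0 : 0 ≤ η := hη ▸ Real.sqrt_nonneg _
  have h' : IsMuonRun T W₀ (fun _ => η) β (fun t => ∇ f (W t)) M W := h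
  have h1 := h'.sum_nuclearNorm_le hη0 hL.le hf hb
  have h3 := fun t => h'.norm_momentum_sub_gradient_le hη0 hL.le hf hβ hβ1 (t := t)
  set r : ℝ := ((min m n : ℕ) : ℝ)
  rcases (initialGap_nonneg (W₀ := W₀) hb).eq_or_lt with hΔ | hΔ
  -- If Δ = 0 then η = 0 and division by η is impossible, but the run never leaves the minimizer
  -- `W₀`.
  · have hη1 : η = 0 := by rw [hη, ← hΔ, zero_div, Real.sqrt_zero]
    have hW : ∀ t ∈ Finset.range T, nuclearNorm (∇ f (W t)) = 0 := by
      intro t ht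
      have h1 := h'.norm_sub_init_le hη0 (Finset.mem_range.1 ht).le
      rw [hη1, zero_mul, mul_zero, norm_le_zero_iff, sub_eq_zero] at h1
      rw [h1, gradient_eq_zero_of_initialGap_le hb hΔ.symm.le, nuclearNorm_zero]
    rw [Finset.sum_eq_zero hW, ← hΔ]
    simp
  · set Δ := initialGap f W₀
    have h2 : ∑ t ∈ Finset.range T, ‖M t - ∇ f (W t)‖ ≤ T * (L * (η * √r) / (1 - β)) := by
      refine (Finset.sum_le_card_nsmul _ _ _ fun t ht => ?_).trans (by rw [Finset.card_range,
        nsmul_eq_mul])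
      have h3 := h3 t (Finset.mem_range.1 ht)
      simp only [sub_self, movingAverage_zero, norm_zero, zero_add] at h3
      exact h3
    have hηsq : η ^ 2 = Δ / (r * T * L) := by rw [hη, Real.sq_sqrt (by positivity)]
    have hηpos : 0 < η := by rw [hη]; positivity
    set S := ∑ t ∈ Finset.range T, nuclearNorm (∇ f (W t))
    -- With this η the smoothness error equals Δ and the drift error equals 2Δ/(1-β), so the total
    -- is (2 + 2/(1-β))Δ.
    have h4 : T * (L * η ^ 2 * r) = Δ := by rw [hηsq]; field_simp
    have h5 : 2 * η * √r * (T * (L * (η * √r) / (1 - β))) = 2 / (1 - β) * Δ := by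
      rw [← h4]
      field_simp
      rw [Real.sq_sqrt hr.le]
    have h6 : η * S ≤ c * Δ := by
      have := mul_le_mul_of_nonneg_left h2 (show 0 ≤ 2 * η * √r by positivity)
      have := mul_le_mul_of_nonneg_right hc hΔ.le
      linarith
    have h7 : Δ = η * T * √(r * L * Δ / T) := by
      have : (η * T * √(r * L * Δ / T)) ^ 2 = Δ ^ 2 := by
        rw [mul_pow, mul_pow, hηsq, Real.sq_sqrt (by positivity)]
        field_simp
      exact ((sq_eq_sq₀ (by positivity) hΔ.le).1 this).symm
    have h8 : η * S ≤ η * (c * T * √(r * L * Δ / T)) := by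
      refine h6.trans_eq ?_
      conv_lhs => rw [h7]
      ring
    have h9 := le_of_mul_le_mul_left h8 hηpos
    rw [one_div, inv_mul_le_iff₀ hT0]
    linarith

end Deterministic

/-! ### Second moments of independent noise. -/

section Noise

variable {Ω Ξ E : Type*} [MeasurableSpace Ω] [MeasurableSpace Ξ] [NormedAddCommGroup E]
  [MeasurableSpace E] [BorelSpace E] {μ : Measure Ω} [IsProbabilityMeasure μ] {D : Measure Ξ}
  [IsProbabilityMeasure D] {h : E → Ξ → E} {w a : Ω → E} {Y : Ω → Ξ} {σ : ℝ}

theorem integrable_norm_of_sq (ha : Measurable a) (hai : Integrable (fun ω => ‖a ω‖ ^ 2) μ) :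
    Integrable (fun ω => ‖a ω‖) μ := by
  refine (hai.add (integrable_const (1 : ℝ))).mono' ha.norm.aestronglyMeasurable
    (Filter.Eventually.of_forall fun ω => ?_)
  simp only [Pi.add_apply, norm_norm]
  nlinarith [sq_nonneg (‖a ω‖ - 1), sq_nonneg ‖a ω‖]

theorem integral_norm_le_of_sq {c : ℝ} (hc : 0 ≤ c) (ha : Measurable a)
    (hai : Integrable (fun ω => ‖a ω‖ ^ 2) μ) (h : ∫ ω, ‖a ω‖ ^ 2 ∂μ ≤ c ^ 2) :
    ∫ ω, ‖a ω‖ ∂μ ≤ c := by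
  have i1 := integrable_norm_of_sq ha hai
  set I := ∫ ω, ‖a ω‖ ∂μ with hI
  -- Nonnegative variance of ‖a‖ gives (E‖a‖)² ≤ E‖a‖².
  have h1 : 0 ≤ ∫ ω, (‖a ω‖ - I) ^ 2 ∂μ := integral_nonneg fun ω => sq_nonneg _
  have h2 : (fun ω => (‖a ω‖ - I) ^ 2) = fun ω => (‖a ω‖ ^ 2 - 2 * I * ‖a ω‖) + I ^ 2 := by
    funext ω
    ring
  have h3 : Integrable (fun ω => ‖a ω‖ ^ 2 - 2 * I * ‖a ω‖) μ := hai.sub (i1.const_mul _)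
  rw [h2, integral_add h3 (integrable_const _), integral_sub hai (i1.const_mul _), integral_const_mul, ← hI] at h1
  simp only [integral_const, probReal_univ, one_smul] at h1
  exact le_of_sq_le_sq (by linarith) hc

/-- Independence makes the joint law a product, so Fubini freezes the iterate `w` and the variance
bound applies pointwise. This takes the place of conditional expectations. -/
theorem integrable_norm_sq_of_indepFun (hh : Measurable (Function.uncurry h))
    (hi : ∀ x, Integrable (fun y => ‖h x y‖ ^ 2) D) (hσ : ∀ x, ∫ y, ‖h x y‖ ^ 2 ∂D ≤ σ ^ 2)
    (hw : Measurable w) (hY : Measurable Y) (hD : μ.map Y = D) (hind : IndepFun w Y μ) :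
    Integrable (fun ω => ‖h (w ω) (Y ω)‖ ^ 2) μ ∧ ∫ ω, ‖h (w ω) (Y ω)‖ ^ 2 ∂μ ≤ σ ^ 2 := by
  have hlaw := hind.map_prod_eq_prod_map_map hw.aemeasurable hY.aemeasurable
  rw [hD] at hlaw
  have : IsProbabilityMeasure (μ.map w) := Measure.isProbabilityMeasure_map hw.aemeasurable
  have hm : Measurable (fun p : E × Ξ => ‖h p.1 p.2‖ ^ 2) := (hh.norm).pow_const 2
  have hbd : ∀ x, ‖∫ y, ‖h x y‖ ^ 2 ∂D‖ ≤ σ ^ 2 := fun x => by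
    rw [Real.norm_of_nonneg (integral_nonneg fun y => by positivity)]
    exact hσ x
  have hint : Integrable (fun p : E × Ξ => ‖h p.1 p.2‖ ^ 2) ((μ.map w).prod D) := by
    rw [integrable_prod_iff hm.aestronglyMeasurable]
    refine ⟨Filter.Eventually.of_forall hi, ?_⟩
    refine Integrable.of_bound (C := σ ^ 2)
      hm.aestronglyMeasurable.norm.integral_prod_right' (Filter.Eventually.of_forall fun x => ?_)
    simpa using hbd x
  have hpair : Measurable fun ω => (w ω, Y ω) := hw.prodMk hY
  refine ⟨?_, ?_⟩
  · rw [← hlaw] at hint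
    exact hint.comp_measurable hpair
  · have h1 := integral_map (μ := μ) hpair.aemeasurable
      (f := fun p : E × Ξ => ‖h p.1 p.2‖ ^ 2) hm.aestronglyMeasurable
    rw [← h1, hlaw, integral_prod _ hint]
    refine (le_abs_self _).trans ?_
    simpa using norm_integral_le_of_norm_le_const (μ := μ.map w)
      (Filter.Eventually.of_forall hbd)

variable [InnerProductSpace ℝ E] [CompleteSpace E] [SecondCountableTopology E]

/-- Orthogonality of martingale differences: once the past is frozen by Fubini, the inner integral
of the noise is zero. -/
theorem integrable_inner_of_indepFun (hh : Measurable (Function.uncurry h))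
    (hi1 : ∀ x, Integrable (h x) D) (h0 : ∀ x, ∫ y, h x y ∂D = 0)
    (hi : ∀ x, Integrable (fun y => ‖h x y‖ ^ 2) D) (hσ : ∀ x, ∫ y, ‖h x y‖ ^ 2 ∂D ≤ σ ^ 2)
    (hw : Measurable w) (ha : Measurable a) (hai : Integrable (fun ω => ‖a ω‖ ^ 2) μ)
    (hY : Measurable Y) (hD : μ.map Y = D) (hind : IndepFun (fun ω => (w ω, a ω)) Y μ) :
    Integrable (fun ω => inner ℝ (a ω) (h (w ω) (Y ω))) μ ∧
      ∫ ω, inner ℝ (a ω) (h (w ω) (Y ω)) ∂μ = 0 := by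
  have hν := integrable_norm_sq_of_indepFun hh hi hσ hw hY hD
    (hind.comp measurable_fst measurable_id)
  have hm : Measurable (fun p : (E × E) × Ξ => inner ℝ p.1.2 (h p.1.1 p.2)) :=
    Measurable.inner (by fun_prop)
      (hh.comp ((measurable_fst.comp measurable_fst).prodMk measurable_snd))
  have hpair : Measurable fun ω => ((w ω, a ω), Y ω) := (hw.prodMk ha).prodMk hY
  have hint : Integrable (fun ω => inner ℝ (a ω) (h (w ω) (Y ω))) μ := by
    refine (hai.add hν.1).mono' (hm.comp hpair).aestronglyMeasurable
      (Filter.Eventually.of_forall fun ω => ?_)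
    refine (norm_inner_le_norm _ _).trans ?_
    simp only [Pi.add_apply]
    nlinarith [sq_nonneg (‖a ω‖ - ‖h (w ω) (Y ω)‖), sq_nonneg ‖a ω‖,
      sq_nonneg ‖h (w ω) (Y ω)‖]
  refine ⟨hint, ?_⟩
  have hlaw := hind.map_prod_eq_prod_map_map (hw.prodMk ha).aemeasurable hY.aemeasurable
  rw [hD] at hlaw
  have hint' := (integrable_map_measure hm.aestronglyMeasurable hpair.aemeasurable (μ := μ)).2 hint
  have h1 := integral_map (μ := μ) hpair.aemeasurable
    (f := fun p : (E × E) × Ξ => inner ℝ p.1.2 (h p.1.1 p.2)) hm.aestronglyMeasurable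
  rw [hlaw] at hint'
  rw [← h1, hlaw, integral_prod _ hint']
  simp only [integral_inner (hi1 _), h0, inner_zero_right, integral_zero]

theorem integrable_norm_sq_add_of_indepFun (hh : Measurable (Function.uncurry h))
    (hi1 : ∀ x, Integrable (h x) D) (h0 : ∀ x, ∫ y, h x y ∂D = 0)
    (hi : ∀ x, Integrable (fun y => ‖h x y‖ ^ 2) D) (hσ : ∀ x, ∫ y, ‖h x y‖ ^ 2 ∂D ≤ σ ^ 2)
    (hw : Measurable w) (ha : Measurable a) (hai : Integrable (fun ω => ‖a ω‖ ^ 2) μ)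
    (hY : Measurable Y) (hD : μ.map Y = D) (hind : IndepFun (fun ω => (w ω, a ω)) Y μ)
    (b c : ℝ) :
    Integrable (fun ω => ‖b • a ω + c • h (w ω) (Y ω)‖ ^ 2) μ ∧
      ∫ ω, ‖b • a ω + c • h (w ω) (Y ω)‖ ^ 2 ∂μ ≤ b ^ 2 * ∫ ω, ‖a ω‖ ^ 2 ∂μ + c ^ 2 * σ ^ 2 := by
  obtain ⟨i1, e1⟩ := integrable_norm_sq_of_indepFun hh hi hσ hw hY hD
    (hind.comp measurable_fst measurable_id)
  obtain ⟨i2, e2⟩ := integrable_inner_of_indepFun hh hi1 h0 hi hσ hw ha hai hY hD hind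
  have e : (fun ω => ‖b • a ω + c • h (w ω) (Y ω)‖ ^ 2) = fun ω =>
      (b ^ 2 * ‖a ω‖ ^ 2 + 2 * b * c * inner ℝ (a ω) (h (w ω) (Y ω)))
        + c ^ 2 * ‖h (w ω) (Y ω)‖ ^ 2 := by
    funext ω
    rw [norm_add_sq_real, norm_smul, norm_smul, inner_smul_left, inner_smul_right, mul_pow,
      mul_pow, Real.norm_eq_abs, Real.norm_eq_abs, sq_abs, sq_abs]
    simp only [conj_trivial]
    ring
  have j1 := hai.const_mul (b ^ 2)
  have j2 := i2.const_mul (2 * b * c)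
  have j3 := i1.const_mul (c ^ 2)
  have j4 : Integrable (fun ω => b ^ 2 * ‖a ω‖ ^ 2
      + 2 * b * c * inner ℝ (a ω) (h (w ω) (Y ω))) μ := j1.add j2
  rw [e]
  refine ⟨j4.add j3, ?_⟩
  rw [integral_add j4 j3, integral_add j1 j2, integral_const_mul, integral_const_mul,
    integral_const_mul, e2]
  have := mul_le_mul_of_nonneg_left e1 (sq_nonneg c)
  linarith

end Noise

/-! ### Measurability of the random iterates. -/

section Iterates

variable {m n T : ℕ} {Ω Ξ : Type*} {ξ : ℕ → Fin 1 → Ω → Ξ}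
  {g : MatrixSpace m n → Ξ → MatrixSpace m n} {W₀ : MatrixSpace m n} {η β : ℝ}
  {M W : ℕ → Ω → MatrixSpace m n}

theorem batchGradient_one (g : MatrixSpace m n → Ξ → MatrixSpace m n) (X : MatrixSpace m n)
    (x : Fin 1 → Ξ) : batchGradient g X x = g X (x 0) := by
  simp [batchGradient]

/-- The SVD need not depend measurably on ω, but `U * Vᵀ` is a limit of continuous functions of `M
t`. The σ-algebra is arbitrary so that the sample filtration can be used. -/
theorem IsStochasticMuonRun.measurable_succ (h : IsStochasticMuonRun T W₀ (fun _ => η) β g ξ M W)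
    {t : ℕ} (ht : t < T) {𝓕 : MeasurableSpace Ω} (hM : Measurable[𝓕] (M t))
    (hW : Measurable[𝓕] (W t)) : Measurable[𝓕] (W (t + 1)) := by
  obtain ⟨q, hq, hlim⟩ := exists_continuous_tendsto_polar m n
  refine measurable_of_tendsto_metrizable (f := fun j ω => W t ω - η • q j (M t ω))
    (fun j => hW.sub (((hq j).measurable.comp hM).const_smul η)) (tendsto_pi_nhds.2 fun ω => ?_)
  obtain ⟨k, U, s, V, hs, hstep⟩ := (h ω).exists_polar ht
  rw [hstep]
  exact ((hlim _ _ _ _ _ hs).const_smul η).const_sub _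

/-- The `σ`-algebra generated by the samples of the iterations before `t`. -/
@[reducible]
def samplesBefore [mΞ : MeasurableSpace Ξ] (T : ℕ) (ξ : ℕ → Fin 1 → Ω → Ξ) (t : ℕ) :
    MeasurableSpace Ω :=
  ⨆ p ∈ {p : Fin T × Fin 1 | (p.1 : ℕ) < t}, mΞ.comap (ξ p.1 p.2)

theorem samplesBefore_mono [MeasurableSpace Ξ] {t u : ℕ} (h : t ≤ u) :
    samplesBefore T ξ t ≤ samplesBefore T ξ u :=
  biSup_mono fun _ hp => lt_of_lt_of_le hp h

theorem measurable_samplesBefore [mΞ : MeasurableSpace Ξ] {t : ℕ} (ht : t < T) :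
    Measurable[samplesBefore T ξ (t + 1)] (ξ t 0) :=
  measurable_iff_comap_le.2 <|
    le_iSup₂_of_le (f := fun (p : Fin T × Fin 1) (_ : p ∈ {p : Fin T × Fin 1 | (p.1 : ℕ) < t + 1})
      => mΞ.comap (ξ p.1 p.2)) (⟨t, ht⟩, 0) (Nat.lt_succ_self t) le_rfl

/-- The shift of index matters: `W t` uses only samples before t, hence is independent of `ξ t 0`,
whereas `M t` already contains that sample. -/
theorem IsStochasticMuonRun.measurable_iterates
    [MeasurableSpace Ξ] (h : IsStochasticMuonRun T W₀ (fun _ => η) β g ξ M W) (hg : Measurable (Function.uncurry g))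
    {t : ℕ} (ht : t < T) :
    Measurable[samplesBefore T ξ t] (W t) ∧ Measurable[samplesBefore T ξ (t + 1)] (M t) := by
  have hG : ∀ {t : ℕ} (ht : t < T), Measurable[samplesBefore T ξ t] (W t) →
      Measurable[samplesBefore T ξ (t + 1)]
        (fun ω => batchGradient g (W t ω) (fun i => ξ t i ω)) := by
    intro t ht hW
    simp only [batchGradient_one]
    exact hg.comp ((hW.mono (samplesBefore_mono t.le_succ) le_rfl).prodMk
      (measurable_samplesBefore ht))
  induction t with
  | zero =>
    have hW : Measurable[samplesBefore T ξ 0] (W 0) := by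
      have : W 0 = fun _ => W₀ := funext fun ω => (h ω).init
      rw [this]
      exact measurable_const
    refine ⟨hW, ?_⟩
    have : M 0 = fun ω => batchGradient g (W 0 ω) (fun i => ξ 0 i ω) :=
      funext fun ω => (h ω).momentum_zero ht
    rw [this]
    exact hG ht hW
  | succ t ih =>
    obtain ⟨hW, hM⟩ := ih (by lia)
    have hW' := h.measurable_succ (by lia) hM (hW.mono (samplesBefore_mono t.le_succ) le_rfl)
    refine ⟨hW', ?_⟩
    have : M (t + 1) = fun ω => β • M t ω
        + (1 - β) • batchGradient g (W (t + 1) ω) (fun i => ξ (t + 1) i ω) :=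
      funext fun ω => (h ω).momentum_succ t ht
    rw [this]
    exact ((hM.mono (samplesBefore_mono (t + 1).le_succ) le_rfl).const_smul β).add
      ((hG ht hW').const_smul (1 - β))

end Iterates

/-! ### Averaged noise and the descent inequality in expectation. -/

section Stochastic

variable {m n : ℕ} {Ω Ξ : Type*} [mΩ : MeasurableSpace Ω] [mΞ : MeasurableSpace Ξ]
  {μ : Measure Ω} {D : Measure Ξ} {T : ℕ} {ξ : ℕ → Fin 1 → Ω → Ξ}

theorem IsIIDSample.samplesBefore_le (h : IsIIDSample μ D T 1 ξ) (t : ℕ) :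
    samplesBefore T ξ t ≤ mΩ :=
  iSup₂_le fun p _ => (h.measurable p.1 p.1.2 p.2).comap_le

theorem IsIIDSample.indep_samplesBefore (h : IsIIDSample μ D T 1 ξ) {t : ℕ} (ht : t < T) :
    Indep (samplesBefore T ξ t) (mΞ.comap (ξ t 0)) μ := by
  have hd : Disjoint {p : Fin T × Fin 1 | (p.1 : ℕ) < t} {(⟨t, ht⟩, 0)} :=
    Set.disjoint_singleton_right.2 (lt_irrefl t)
  have := indep_iSup_of_disjoint (fun p : Fin T × Fin 1 => (h.measurable p.1 p.1.2 p.2).comap_le)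
    ((iIndepFun_iff_iIndep _ _ _).1 h.indep) hd
  rwa [iSup_singleton] at this

theorem IsIIDSample.indepFun {E : Type*} [MeasurableSpace E] (h : IsIIDSample μ D T 1 ξ) {t : ℕ}
    (ht : t < T) {X : Ω → E} (hX : Measurable[samplesBefore T ξ t] X) : IndepFun X (ξ t 0) μ :=
  (IndepFun_iff_Indep _ _ _).2 <|
    indep_of_indep_of_le_left (h.indep_samplesBefore ht) (measurable_iff_comap_le.1 hX)

variable {g : MatrixSpace m n → Ξ → MatrixSpace m n} {W₀ : MatrixSpace m n} {η β : ℝ}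
  {M W : ℕ → Ω → MatrixSpace m n}

variable {F : MatrixSpace m n → Ξ → ℝ} {f : MatrixSpace m n → ℝ} {σ L : ℝ}
  [IsProbabilityMeasure μ]

/-- Each step has length at most η√r, so `W t` stays in a fixed ball around `W₀`, on which the
gradient is bounded. -/
theorem IsStochasticMuonRun.integrable_nuclearNorm
    (h : IsStochasticMuonRun T W₀ (fun _ => η) β g ξ M W) (hL : 0 ≤ L) (hη : 0 ≤ η)
    (hf : IsFrobeniusSmooth f L) (hg : Measurable (Function.uncurry g))
    (hξ : IsIIDSample μ D T 1 ξ) {t : ℕ} (ht : t < T) :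
    Integrable (fun ω => nuclearNorm (∇ f (W t ω))) μ := by
  have hW := (h.measurable_iterates hg ht).1.mono (hξ.samplesBefore_le _) le_rfl
  refine Integrable.of_bound
    (C := √(min m n : ℕ) * (‖∇ f W₀‖ + L * (t * (η * √(min m n : ℕ)))))
    ((continuous_nuclearNorm.comp (hf.continuous_gradient hL)).measurable.comp
      hW).aestronglyMeasurable (Filter.Eventually.of_forall fun ω => ?_)
  rw [Real.norm_of_nonneg (nuclearNorm_nonneg _)]
  refine (nuclearNorm_le_norm _).trans ?_
  gcongr
  refine (norm_le_norm_add_norm_sub' _ (∇ f W₀)).trans ?_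
  gcongr
  refine (hf.2 _ _).trans ?_
  gcongr
  exact (h ω).norm_sub_init_le hη ht.le

variable [IsProbabilityMeasure D]

/-- The averaged gradient noise has small second moments. -/
theorem IsStochasticMuonRun.movingAverage_noise
    (h : IsStochasticMuonRun T W₀ (fun _ => η) β g ξ M W) (hL : 0 ≤ L)
    (hf : IsFrobeniusSmooth f L) (ho : IsStochasticObjective D F g f σ)
    (hξ : IsIIDSample μ D T 1 ξ) (hβ : 0 ≤ β) (hβ1 : β < 1) {t : ℕ} (ht : t < T) :
    Measurable[samplesBefore T ξ (t + 1)]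
        (fun ω => movingAverage β (fun t => g (W t ω) (ξ t 0 ω) - ∇ f (W t ω)) t) ∧
      Integrable (fun ω => ‖movingAverage β
        (fun t => g (W t ω) (ξ t 0 ω) - ∇ f (W t ω)) t‖ ^ 2) μ ∧
      ∫ ω, ‖movingAverage β (fun t => g (W t ω) (ξ t 0 ω) - ∇ f (W t ω)) t‖ ^ 2 ∂μ
        ≤ (β ^ (2 * t) + (1 - β)) * σ ^ 2 := by
  have hcont := (hf.continuous_gradient hL).measurable
  have hh : Measurable (Function.uncurry fun X x => g X x - ∇ f X) :=
    ho.measurable_gradient.sub (hcont.comp measurable_fst)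
  have hi1 : ∀ X, Integrable (fun x => g X x - ∇ f X) D := fun X =>
    (ho.integrable_gradient X).sub (integrable_const _)
  have h0 : ∀ X, ∫ x, (g X x - ∇ f X) ∂D = 0 := fun X => by
    rw [integral_sub (ho.integrable_gradient X) (integrable_const _), ho.unbiased]
    simp
  have hν : ∀ {t : ℕ} (ht : t < T), Measurable[samplesBefore T ξ (t + 1)]
      (fun ω => g (W t ω) (ξ t 0 ω) - ∇ f (W t ω)) := fun {t} ht =>
    hh.comp (((h.measurable_iterates ho.measurable_gradient ht).1.mono
      (samplesBefore_mono t.le_succ) le_rfl).prodMk (measurable_samplesBefore ht))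
  induction t with
  | zero =>
    have hW := (h.measurable_iterates ho.measurable_gradient ht).1
    obtain ⟨i, e⟩ := integrable_norm_sq_of_indepFun hh ho.integrable_sq ho.variance_le
      (hW.mono (hξ.samplesBefore_le 0) le_rfl) (hξ.measurable 0 ht 0) (hξ.law 0 ht 0)
      (hξ.indepFun ht hW)
    refine ⟨hν ht, i, e.trans ?_⟩
    have : 0 ≤ (1 - β) * σ ^ 2 := mul_nonneg (by linarith) (sq_nonneg _)
    simp only [mul_zero, pow_zero]
    linarith
  | succ t ih =>
    obtain ⟨ma, ia, ea⟩ := ih (by lia)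
    have hW := (h.measurable_iterates ho.measurable_gradient ht).1
    obtain ⟨i, e⟩ := integrable_norm_sq_add_of_indepFun hh hi1 h0 ho.integrable_sq ho.variance_le
      (hW.mono (hξ.samplesBefore_le _) le_rfl) (ma.mono (hξ.samplesBefore_le _) le_rfl) ia
      (hξ.measurable _ ht 0) (hξ.law _ ht 0) (hξ.indepFun ht (hW.prodMk ma)) β (1 - β)
    refine ⟨((ma.mono (samplesBefore_mono (t + 1).le_succ) le_rfl).const_smul β).add
      ((hν ht).const_smul (1 - β)), i, e.trans ?_⟩
    -- With α = 1-β, the recursion closes because β²α + α² ≤ α, which amounts to β² ≤ β.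
    have h1 := mul_le_mul_of_nonneg_left ea (sq_nonneg β)
    have h2 : β ^ (2 * (t + 1)) = β ^ 2 * β ^ (2 * t) := by rw [mul_add, pow_add]; ring
    rw [h2]
    nlinarith [mul_nonneg (mul_nonneg hβ (sub_nonneg.2 hβ1.le)) (sq_nonneg σ)]

/-- The root of β^(2t) + (1-β) is at most β^t + √(1-β); the first summand adds up to at most 1/(1-β)
however large T is. -/
theorem sum_integral_movingAverage_noise_le
    (h : IsStochasticMuonRun T W₀ (fun _ => η) β g ξ M W) (hL : 0 ≤ L)
    (hf : IsFrobeniusSmooth f L) (ho : IsStochasticObjective D F g f σ) (hσ : 0 ≤ σ)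
    (hξ : IsIIDSample μ D T 1 ξ) (hβ : 0 ≤ β) (hβ1 : β < 1) :
    ∑ t ∈ Finset.range T,
        ∫ ω, ‖movingAverage β (fun t => g (W t ω) (ξ t 0 ω) - ∇ f (W t ω)) t‖ ∂μ
      ≤ σ / (1 - β) + T * (√(1 - β) * σ) := by
  have hα : 0 < 1 - β := by linarith
  have h1 : ∀ t ∈ Finset.range T,
      ∫ ω, ‖movingAverage β (fun t => g (W t ω) (ξ t 0 ω) - ∇ f (W t ω)) t‖ ∂μ
        ≤ β ^ t * σ + √(1 - β) * σ := by
    intro t ht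
    obtain ⟨ma, ia, ea⟩ := h.movingAverage_noise hL hf ho hξ hβ hβ1 (Finset.mem_range.1 ht)
    refine integral_norm_le_of_sq (by positivity) (ma.mono (hξ.samplesBefore_le _) le_rfl) ia
      (ea.trans ?_)
    have h2 := Real.sq_sqrt hα.le
    have h3 : 0 ≤ 2 * (β ^ t * √(1 - β)) * σ ^ 2 := by positivity
    calc (β ^ (2 * t) + (1 - β)) * σ ^ 2 = ((β ^ t) ^ 2 + √(1 - β) ^ 2) * σ ^ 2 := by
          rw [h2, pow_mul']
      _ ≤ (β ^ t * σ + √(1 - β) * σ) ^ 2 := by linarith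
  refine (Finset.sum_le_sum h1).trans ?_
  rw [Finset.sum_add_distrib, ← Finset.sum_mul, Finset.sum_const, Finset.card_range,
    nsmul_eq_mul]
  gcongr
  rw [div_eq_inv_mul]
  gcongr
  rw [← tsum_geometric_of_lt_one hβ hβ1]
  exact (summable_geometric_of_lt_one hβ hβ1).sum_le_tsum _ fun t _ => pow_nonneg hβ t

theorem IsStochasticMuonRun.sum_integral_nuclearNorm_le
    (h : IsStochasticMuonRun T W₀ (fun _ => η) β g ξ M W) (hL : 0 ≤ L) (hη : 0 ≤ η)
    (hf : IsFrobeniusSmooth f L) (hb : BddBelow (Set.range f))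
    (ho : IsStochasticObjective D F g f σ) (hσ : 0 ≤ σ)
    (hξ : IsIIDSample μ D T 1 ξ) (hβ : 0 ≤ β) (hβ1 : β < 1) :
    η * ∑ t ∈ Finset.range T, ∫ ω, nuclearNorm (∇ f (W t ω)) ∂μ ≤
      initialGap f W₀ + T * (L * η ^ 2 * (min m n : ℕ))
        + 2 * η * √(min m n : ℕ) * (σ / (1 - β) + T * (√(1 - β) * σ)
          + T * (L * (η * √(min m n : ℕ)) / (1 - β))) := by
  set a : ℕ → Ω → MatrixSpace m n := fun t ω =>
    movingAverage β (fun t => g (W t ω) (ξ t 0 ω) - ∇ f (W t ω)) t with ha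
  set K := L * (η * √(min m n : ℕ)) / (1 - β) with hK
  have hpath : ∀ ω, η * ∑ t ∈ Finset.range T, nuclearNorm (∇ f (W t ω)) ≤
      initialGap f W₀ + T * (L * η ^ 2 * (min m n : ℕ))
        + 2 * η * √(min m n : ℕ) * (∑ t ∈ Finset.range T, ‖a t ω‖ + T * K) := by
    intro ω
    refine ((h ω).sum_nuclearNorm_le hη hL hf hb).trans ?_
    gcongr
    refine (Finset.sum_le_sum fun t ht => (h ω).norm_momentum_sub_gradient_le hη hL hf hβ hβ1
      (Finset.mem_range.1 ht)).trans_eq ?_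
    rw [Finset.sum_add_distrib, Finset.sum_const, Finset.card_range, nsmul_eq_mul]
    simp only [batchGradient_one, ha, hK]
  have hN : ∀ t ∈ Finset.range T, Integrable (fun ω => nuclearNorm (∇ f (W t ω))) μ :=
    fun t ht => h.integrable_nuclearNorm hL hη hf ho.measurable_gradient hξ
      (Finset.mem_range.1 ht)
  have hA : ∀ t ∈ Finset.range T, Integrable (fun ω => ‖a t ω‖) μ := fun t ht => by
    obtain ⟨ma, ia, -⟩ := h.movingAverage_noise hL hf ho hξ hβ hβ1 (Finset.mem_range.1 ht)
    exact integrable_norm_of_sq (ma.mono (hξ.samplesBefore_le _) le_rfl) ia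
  have hAs := integrable_finsetSum _ hA
  have hAK := (hAs.add (integrable_const (T * K))).const_mul (2 * η * √(min m n : ℕ))
  have hmono := integral_mono ((integrable_finsetSum _ hN).const_mul η)
    ((integrable_const (initialGap f W₀ + T * (L * η ^ 2 * (min m n : ℕ)))).add hAK) hpath
  simp only [Pi.add_apply] at hmono hAK
  rw [integral_const_mul, integral_finsetSum _ hN, integral_add (integrable_const _) hAK,
    integral_const_mul, integral_add hAs (integrable_const _),
    integral_finsetSum _ hA] at hmono
  simp only [integral_const, probReal_univ, one_smul] at hmono
  refine hmono.trans ?_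
  gcongr
  exact sum_integral_movingAverage_noise_le h hL hf ho hσ hξ hβ hβ1

end Stochastic

/-! ### Arithmetic of the rates. -/

section Rates

theorem exists_le_of_average_le {T : ℕ} {ε : ℝ} (hT : 1 ≤ T) {N : ℕ → ℝ}
    (h : (1 / (T : ℝ)) * ∑ t ∈ Finset.range T, N t ≤ ε) : ∃ t < T, N t ≤ ε := by
  have hT0 : (0 : ℝ) < T := by exact_mod_cast hT
  rw [one_div, inv_mul_le_iff₀ hT0] at h
  obtain ⟨t, ht, hle⟩ := Finset.exists_le_of_sum_le (s := Finset.range T) (f := N)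
    (g := fun _ => ε) (Finset.nonempty_range_iff.2 (by lia)) (by simpa using h)
  exact ⟨t, Finset.mem_range.1 ht, hle⟩

theorem rpow_quarter_eq_sqrt {x p q σ : ℝ} (hx : 0 < x) (hp : 0 < p) (hq : 0 < q) (hσ : 0 < σ) :
    (((x ^ 2) ^ 2 * p ^ 2 * σ ^ 2 / q ^ 2) ^ (1 / 4 : ℝ)) = √(x ^ 2 * p * σ / q) := by
  have h : (x ^ 2) ^ 2 * p ^ 2 * σ ^ 2 / q ^ 2 = √(x ^ 2 * p * σ / q) ^ 4 := by
    rw [show √(x ^ 2 * p * σ / q) ^ 4 = (√(x ^ 2 * p * σ / q) ^ 2) ^ 2 by ring,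
      Real.sq_sqrt (by positivity)]
    ring
  rw [h, show (1 / 4 : ℝ) = ((4 : ℕ) : ℝ)⁻¹ by norm_num,
    Real.pow_rpow_inv_natCast (Real.sqrt_nonneg _) (by norm_num)]

/-- The descent inequality with the prescribed step size and momentum yields the stochastic rate;
here `x = √r`, `p = √(L Δ)` and `q = √T`. -/
theorem average_le_of_descent {x p q σ α L Δ η S : ℝ} (hx : 0 < x) (hp : 0 < p) (hq : 1 ≤ q)
    (hσ : 0 < σ) (hL : 0 < L) (hΔ : 0 < Δ) (hpL : p ^ 2 = L * Δ) (hα : α = min (p / (σ * q)) 1)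
    (hη : η = √(α * Δ / (x ^ 2 * q ^ 2 * L)))
    (hS : η * S ≤ Δ + q ^ 2 * (L * η ^ 2 * x ^ 2)
      + 2 * η * x * (σ / α + q ^ 2 * (√α * σ) + q ^ 2 * (L * (η * x) / α))) :
    1 / q ^ 2 * S ≤ 8 * (√(x ^ 2 * p * σ / q) + x * p / q + x * σ ^ 2 / (p * q)) := by
  have hq0 : 0 < q := by linarith
  have hα0 : 0 < α := by rw [hα]; exact lt_min (by positivity) one_pos
  have hα1 : α ≤ 1 := hα ▸ min_le_right _ _
  have hη0 : 0 < η := by rw [hη]; positivity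
  have hηsq : η ^ 2 = α * Δ / (x ^ 2 * q ^ 2 * L) := by rw [hη, Real.sq_sqrt (by positivity)]
  -- `R` is Δ/(ηT). Initial gap, smoothness and drift contribute Δ + αΔ + 2Δ ≤ 4Δ, hence the later
  -- 4R.
  set R := √(x ^ 2 * p ^ 2 / (α * q ^ 2)) with hR
  have hR0 : 0 < R := by positivity
  have hΔR : Δ = η * q ^ 2 * R := by
    have : (η * q ^ 2 * R) ^ 2 = Δ ^ 2 := by
      rw [mul_pow, mul_pow, hηsq, hR, Real.sq_sqrt (by positivity), hpL]
      field_simp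
    exact ((sq_eq_sq₀ (by positivity) hΔ.le).1 this).symm
  have e1 : q ^ 2 * (L * η ^ 2 * x ^ 2) = α * Δ := by rw [hηsq]; field_simp
  have e2 : 2 * η * x * (q ^ 2 * (L * (η * x) / α)) = 2 * Δ := by
    have : 2 * η * x * (q ^ 2 * (L * (η * x) / α)) = 2 * (q ^ 2 * (L * η ^ 2 * x ^ 2)) / α := by
      ring
    rw [this, e1]
    field_simp
  have e3 : η * S ≤ η * (q ^ 2 * (4 * R + 2 * (x * σ / (α * q ^ 2)) + 2 * (x * √α * σ))) := by
    have h1 : α * Δ ≤ Δ := mul_le_of_le_one_left hΔ.le hα1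
    have h2 : η * (q ^ 2 * (4 * R + 2 * (x * σ / (α * q ^ 2)) + 2 * (x * √α * σ)))
        = 4 * (η * q ^ 2 * R) + 2 * η * x * (σ / α + q ^ 2 * (√α * σ)) := by
      field_simp
      ring
    rw [h2, ← hΔR]
    rw [mul_add (2 * η * x), e1, e2] at hS
    linarith
  have e4 : 1 / q ^ 2 * S ≤ 4 * R + 2 * (x * σ / (α * q ^ 2)) + 2 * (x * √α * σ) := by
    rw [one_div, inv_mul_le_iff₀ (by positivity)]
    exact le_of_mul_le_mul_left e3 hη0
  refine e4.trans ?_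
  have p1 : 0 ≤ √(x ^ 2 * p * σ / q) := Real.sqrt_nonneg _
  have p2 : 0 ≤ x * p / q := by positivity
  have p3 : 0 ≤ x * σ ^ 2 / (p * q) := by positivity
  -- In the noisy regime α = p/(σq) makes `R` and x√α σ both equal to the fourth-root term.
  -- Otherwise α = 1 and σq ≤ p, so all terms are at most multiples of xp/q, with 4 + 2 + 2 = 8.
  rcases le_total (p / (σ * q)) 1 with hc | hc
  · rw [min_eq_left hc] at hα
    have h1 : R = √(x ^ 2 * p * σ / q) := by
      rw [hR, hα]
      congr 1
      field_simp
    have h2 : x * σ / (α * q ^ 2) = x * σ ^ 2 / (p * q) := by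
      rw [hα]
      field_simp
    have h3 : x * √α * σ = √(x ^ 2 * p * σ / q) := by
      symm
      rw [Real.sqrt_eq_iff_mul_self_eq (by positivity) (by positivity)]
      have := Real.mul_self_sqrt hα0.le
      symm
      calc x * √α * σ * (x * √α * σ) = x ^ 2 * σ ^ 2 * (√α * √α) := by ring
        _ = x ^ 2 * p * σ / q := by
          rw [this, hα]
          field_simp
    rw [h1, h2, h3]
    linarith
  · rw [min_eq_right hc] at hα
    have hσq : σ * q ≤ p := by rwa [one_le_div (by positivity)] at hc
    have h1 : R = x * p / q := by
      rw [hR, hα, show x ^ 2 * p ^ 2 / (1 * q ^ 2) = (x * p / q) ^ 2 by ring,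
        Real.sqrt_sq p2]
    have h3 : x * σ ≤ x * p / q := by
      rw [le_div_iff₀ hq0, mul_assoc]
      gcongr
    have h2 : x * σ / (1 * q ^ 2) ≤ x * σ := by
      rw [one_mul]
      exact div_le_self (by positivity) (one_le_pow₀ hq)
    rw [h1, hα, Real.sqrt_one, mul_one]
    linarith

/-- The stochastic rate is small once the number of iterations is large. -/
theorem rate_le_of_iterations {x p q σ ε : ℝ} (hx : 0 < x) (hp : 0 < p) (hq : 0 < q)
    (hσ : 0 < σ) (hε : 0 < ε) (h1 : ε ≤ x * σ) (h2 : σ * ε ≤ x * p ^ 2)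
    (hT : 810000 * ((x ^ 2) ^ 2 * p ^ 2 * σ ^ 2 / ε ^ 4) ≤ q ^ 2) :
    8 * (√(x ^ 2 * p * σ / q) + x * p / q + x * σ ^ 2 / (p * q)) ≤ ε := by
  -- Here 810000 = 900² and 900 = 30²: each of the three terms is at most ε/30, and 8 · 3/30 < 1.
  -- The two upper bounds on ε make the second and third terms no worse than the first.
  have hq' : 900 * (x ^ 2 * p * σ / ε ^ 2) ≤ q := by
    refine le_of_sq_le_sq (le_trans (le_of_eq ?_) hT) hq.le
    ring
  have hq2 : 900 * (x ^ 2 * p * σ) ≤ q * ε ^ 2 := by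
    rwa [← mul_div_assoc, div_le_iff₀ (by positivity)] at hq'
  have t1 : √(x ^ 2 * p * σ / q) ≤ ε / 30 := by
    refine Real.sqrt_le_iff.2 ⟨by positivity, ?_⟩
    rw [div_le_iff₀ hq]
    linarith
  have t2 : x * p / q ≤ ε / 30 := by
    rw [div_le_iff₀ hq]
    have a1 : ε * (900 * (x * p)) ≤ ε * (q * ε) := by
      calc ε * (900 * (x * p)) ≤ x * σ * (900 * (x * p)) := by gcongr
        _ ≤ ε * (q * ε) := by linarith
    have a2 := le_of_mul_le_mul_left a1 hε
    have : 0 < q * ε := by positivity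
    linarith
  have t3 : x * σ ^ 2 / (p * q) ≤ ε / 30 := by
    rw [div_le_iff₀ (by positivity)]
    have a1 : (x * p * ε) * (900 * (x * σ ^ 2)) ≤ (x * p * ε) * (ε * (p * q)) := by
      calc (x * p * ε) * (900 * (x * σ ^ 2)) = (900 * (x ^ 2 * p * σ)) * (σ * ε) := by ring
        _ ≤ (q * ε ^ 2) * (x * p ^ 2) := by gcongr
        _ = (x * p * ε) * (ε * (p * q)) := by ring
    have a2 := le_of_mul_le_mul_left a1 (by positivity)
    have : 0 < ε * (p * q) := by positivity
    linarith
  linarith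

end Rates

end Muon

/-! ### Assembly of both settings. -/

theorem mainTheorem12 :
    -- stochastic setting
    (∃ C : ℝ, 0 < C ∧
      ∀ (m n : ℕ), 0 < m → 0 < n →
      ∀ (Ω Ξ : Type*) [MeasurableSpace Ω] [MeasurableSpace Ξ]
        (μ : Measure Ω) [IsProbabilityMeasure μ] (D : Measure Ξ) [IsProbabilityMeasure D]
        (F : Muon.MatrixSpace m n → Ξ → ℝ)
        (g : Muon.MatrixSpace m n → Ξ → Muon.MatrixSpace m n)
        (f : Muon.MatrixSpace m n → ℝ) (W₀ : Muon.MatrixSpace m n) (L σ r Δ η β : ℝ) (T : ℕ)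
        (ξ : ℕ → Fin 1 → Ω → Ξ) (M W : ℕ → Ω → Muon.MatrixSpace m n),
        r = (min m n : ℕ) → Δ = Muon.initialGap f W₀ →
        0 < L → 0 < σ → 0 < Δ → 1 ≤ T →
        BddBelow (Set.range f) →
        Muon.IsFrobeniusSmooth f L →
        Muon.IsStochasticObjective D F g f σ →
        η = √((1 - β) * Δ / (r * T * L)) →
        1 - β = min (√(L * Δ) / (σ * √T)) 1 →
        Muon.IsIIDSample μ D T 1 ξ →
        Muon.IsStochasticMuonRun T W₀ (fun _ => η) β g ξ M W →
        (∀ t < T, Integrable (fun ω => Muon.nuclearNorm (∇ f (W t ω))) μ) ∧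
        (1 / (T : ℝ)) * ∑ t ∈ Finset.range T, ∫ ω, Muon.nuclearNorm (∇ f (W t ω)) ∂μ ≤
          C * ((r ^ 2 * L * Δ * σ ^ 2 / T) ^ (1 / 4 : ℝ) + √(r * L * Δ / T)
            + √r * σ ^ 2 / √(L * Δ * T)) ∧
        ∀ ε : ℝ, 0 < ε → ε ≤ √r * σ → σ * ε ≤ √r * L * Δ →
          C * (r ^ 2 * L * σ ^ 2 * Δ / ε ^ 4) ≤ T →
          (1 / (T : ℝ)) * ∑ t ∈ Finset.range T, ∫ ω, Muon.nuclearNorm (∇ f (W t ω)) ∂μ ≤ ε ∧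
          ∃ t < T, ∫ ω, Muon.nuclearNorm (∇ f (W t ω)) ∂μ ≤ ε) ∧
    -- deterministic setting
    (∀ β₀ : ℝ, 0 ≤ β₀ → β₀ < 1 → ∃ C : ℝ, 0 < C ∧
      ∀ (m n : ℕ), 0 < m → 0 < n →
      ∀ (f : Muon.MatrixSpace m n → ℝ) (W₀ : Muon.MatrixSpace m n) (L r Δ η β : ℝ) (T : ℕ)
        (M W : ℕ → Muon.MatrixSpace m n),
        r = (min m n : ℕ) → Δ = Muon.initialGap f W₀ →
        0 < L → 1 ≤ T →
        BddBelow (Set.range f) →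
        Muon.IsFrobeniusSmooth f L →
        η = √(Δ / (r * T * L)) →
        0 ≤ β → β ≤ β₀ →
        Muon.IsDeterministicMuonRun T W₀ (fun _ => η) β f M W →
        (1 / (T : ℝ)) * ∑ t ∈ Finset.range T, Muon.nuclearNorm (∇ f (W t)) ≤
          C * √(r * L * Δ / T) ∧
        ∀ ε : ℝ, 0 < ε → C * (r * L * Δ / ε ^ 2) ≤ T →
          (1 / (T : ℝ)) * ∑ t ∈ Finset.range T, Muon.nuclearNorm (∇ f (W t)) ≤ ε ∧
          ∃ t < T, Muon.IsNuclearStationary f ε (W t)) := by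
  -- One constant must serve both the rate and the iteration count. The stochastic rate needs only
  -- 8. The deterministic rate has c = 2 + 2/(1-β₀) ≥ 1, while the count needs c² because the rate
  -- is squared.
  refine ⟨⟨810000, by norm_num, ?_⟩, fun β₀ hβ₀ hβ₀1 => ⟨(2 + 2 / (1 - β₀)) ^ 2, ?_, ?_⟩⟩
  · intro m n hm hn Ω Ξ _ _ μ _ D _ F g f W₀ L σ r Δ η β T ξ M W hr hΔ hL hσ hΔ0 hT hb hf ho hη
      hβα hξ hrun
    have hr0 : 0 < r := by rw [hr]; exact_mod_cast lt_min hm hn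
    have hT0 : (0 : ℝ) < T := by exact_mod_cast hT
    have hα0 : 0 < 1 - β := by rw [hβα]; exact lt_min (by positivity) one_pos
    have hβ : 0 ≤ β := by linarith [hβα.trans_le (min_le_right _ _)]
    have hη0 : 0 ≤ η := hη ▸ Real.sqrt_nonneg _
    have key := hrun.sum_integral_nuclearNorm_le hL.le hη0 hf hb ho hσ.le hξ hβ (by linarith)
    rw [← hr, ← hΔ] at key
    set S := ∑ t ∈ Finset.range T, ∫ ω, Muon.nuclearNorm (∇ f (W t ω)) ∂μ
    have hx : 0 < √r := Real.sqrt_pos.2 hr0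
    have hp : 0 < √(L * Δ) := by positivity
    have hq : 0 < √(T : ℝ) := by positivity
    have ex : √r ^ 2 = r := Real.sq_sqrt hr0.le
    have ep : √(L * Δ) ^ 2 = L * Δ := Real.sq_sqrt (by positivity)
    have eq : √(T : ℝ) ^ 2 = T := Real.sq_sqrt hT0.le
    have hmain := Muon.average_le_of_descent (x := √r) (p := √(L * Δ)) (q := √T) (η := η) (S := S) hx hp
      (Real.one_le_sqrt.2 (by exact_mod_cast hT)) hσ hL hΔ0 ep hβα (by rw [ex, eq, hη])
      (by rw [ex, eq]; exact key)
    have t1 := Muon.rpow_quarter_eq_sqrt hx hp hq hσ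
    rw [ex, ep, eq, ← mul_assoc (r ^ 2)] at t1
    have t2 : √(r * L * Δ / T) = √r * √(L * Δ) / √T := by
      rw [mul_assoc, Real.sqrt_div (by positivity), Real.sqrt_mul hr0.le]
    have t3 : √(L * Δ * T) = √(L * Δ) * √T := Real.sqrt_mul (by positivity) _
    refine ⟨fun t ht => hrun.integrable_nuclearNorm hL.le hη0 hf ho.measurable_gradient hξ ht,
      ?_, ?_⟩
    · rw [t1, t2, t3]
      rw [eq, ex] at hmain
      refine hmain.trans (mul_le_mul_of_nonneg_right (by norm_num) (by positivity))
    · intro ε hε h1 h2 h3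
      have hle := hmain.trans (Muon.rate_le_of_iterations hx hp hq hσ hε h1
        (by rw [ep, ← mul_assoc]; exact h2)
        (by
          rw [ex, ep, eq]
          refine le_trans (le_of_eq ?_) h3
          ring))
      rw [eq] at hle
      exact ⟨hle, Muon.exists_le_of_average_le hT hle⟩
  · have : 0 < 1 - β₀ := by linarith
    positivity
  · intro m n hm hn f W₀ L r Δ η β T M W hr hΔ hL hT hb hf hη hβ hββ₀ hrun
    have hα₀ : 0 < 1 - β₀ := by linarith
    have hr0 : 0 < r := by rw [hr]; exact_mod_cast lt_min hm hn
    have hT0 : (0 : ℝ) < T := by exact_mod_cast hT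
    have hΔ0 : 0 ≤ Δ := hΔ ▸ Muon.initialGap_nonneg hb
    have hc : 2 + 2 / (1 - β) ≤ 2 + 2 / (1 - β₀) := by gcongr
    have hmain := hrun.average_nuclearNorm_le hm hn hL hT hb hf (by rw [hη, hr, hΔ]) hβ
      (by linarith) hc
    rw [← hr, ← hΔ] at hmain
    set c := 2 + 2 / (1 - β₀) with hcdef
    have hc1 : 1 ≤ c := by
      have : 0 < 2 / (1 - β₀) := by positivity
      linarith
    refine ⟨hmain.trans (mul_le_mul_of_nonneg_right (by nlinarith) (Real.sqrt_nonneg _)), ?_⟩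
    intro ε hε h
    have hle : c * √(r * L * Δ / T) ≤ ε := by
      refine le_of_sq_le_sq ?_ hε.le
      rw [mul_pow, Real.sq_sqrt (by positivity), ← mul_div_assoc, div_le_iff₀ hT0]
      rwa [← mul_div_assoc, div_le_iff₀ (by positivity), mul_comm (T : ℝ)] at h
    exact ⟨hmain.trans hle, Muon.exists_le_of_average_le hT (hmain.trans hle)⟩
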